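/- For a finite simple graph $G$ on the vertex set $\{1,\dots,n\}$, the edge polytope $\mathcal P(G)\subseteq\mathbb R^n$ is the convex hull of all vectors $e_i+e_j$ with $i$ adjacent to $j$, where $e_i$ is the $i$th unit vector. For $d\in\mathbb N$ let $f(d)$ be the maximal number of facets of $\mathcal P(G)$, where $G$ ranges over all finite connected simple graphs (on any number of vertices) with $\dim\mathcal P(G)=d$. **Theorem.** For every integer $d\ge 3$ this maximum exists and $$4^{\lfloor d/3\rfloor}<f(d)\le 2^d+d .$$ Moreover, for every $k\ge 1$ let $\mathrm{Wd}(4,k)$ be the windmill graph, consisting of $k$ copies of the complete graph $K_4$ that share one common vertex and are otherwise disjoint. It is connected, and its edge polytope has dimension $3k$ and exactly $4^k+3k+1$ facets. -/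

import Mathlib

namespace EdgePolytope

/-- The edge polytope of a graph `G` on the vertex set `V`: the convex hull in `ℝ^V` of all vectors
`e_i + e_j` with `i` adjacent to `j`. -/
def edgePolytope {V : Type*} [DecidableEq V] (G : SimpleGraph V) : Set (V → ℝ) :=
  convexHull ℝ {x : V → ℝ | ∃ i j : V, G.Adj i j ∧ x = Pi.single i 1 + Pi.single j 1}

open Classical in
/-- The dimension of a convex set: the dimension of its affine hull, and `-1` for the empty set. -/
noncomputable def convexDim {V : Type*} (S : Set (V → ℝ)) : ℤ :=
  if S.Nonempty then (Module.finrank ℝ (affineSpan ℝ S).direction : ℤ) else -1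

/-- `F` is a facet of the polytope `P`: a face (the empty set, or the set of points of `P` at which
some linear functional is maximal on `P`) of dimension `dim P - 1`. -/
def IsFacet {V : Type*} (P F : Set (V → ℝ)) : Prop :=
  IsExposed ℝ P F ∧ convexDim F = convexDim P - 1

/-- The number of facets, as an extended natural number. -/
noncomputable def numFacets {V : Type*} (P : Set (V → ℝ)) : ℕ∞ :=
  {F : Set (V → ℝ) | IsFacet P F}.encard

/-- All facet numbers of `d`-dimensional edge polytopes of finite connected graphs. -/
def facetNumbers (d : ℕ) : Set ℕ∞ :=
  {m | ∃ (n : ℕ) (G : SimpleGraph (Fin n)), G.Connected ∧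
    convexDim (edgePolytope G) = (d : ℤ) ∧ numFacets (edgePolytope G) = m}

/-- `f(d)`: the maximal number of facets of a `d`-dimensional edge polytope of a finite connected
graph (the supremum in `ℕ∞`). -/
noncomputable def maxFacets (d : ℕ) : ℕ∞ := sSup (facetNumbers d)

/-- The windmill graph `Wd(4, k)`: `k` copies of the complete graph `K₄` glued at one common vertex.
The vertex `none` is the common vertex, and `some (i, a)` with `a = 0, 1, 2` are the other three
vertices of the `i`-th copy. -/
def windmill (k : ℕ) : SimpleGraph (Option (Fin k × Fin 3)) where
  Adj x y := x ≠ y ∧ ∀ p q : Fin k × Fin 3, x = some p → y = some q → p.1 = q.1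
  symm := ⟨fun _ _ h => ⟨h.1.symm, fun p q hp hq => (h.2 q p hq hp).symm⟩⟩
  loopless := ⟨fun _ h => h.1 rfl⟩

end EdgePolytope

/-!
A linear functional `a` that is nonnegative on the edge polytope of `G` cuts out the face spanned by
the tight edges, those `ij` with `a i + a j = 0`. All edge vectors lie on the hyperplane `∑ x = 2`,
so the dimension of this face is `|V| - 1` minus the dimension of the space `tightKer G a` of
functionals vanishing on the tight edges (`convexDim_face`). Hence facets are the faces for which
this space is one dimension larger than the space `tightKer G 0` of functionals vanishing on all
edges (`isFacet_edgePolytope_iff`). For connected `G` the latter is zero, or, in the bipartite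
case, spanned by the signing of the two sides.

The space `tightKer G a` is closed under applying odd functions to the values of a vector. As it is
so small, a facet normal `a` must be, up to the obvious changes, a vector with entries in
`{-1, 0, 1}`: apply the sign function if `G` is not bipartite (`exists_isSignVector_smul`), or a
threshold along the signing if `G` is bipartite (`exists_isSignVector_of_bipartite`). Such a normal
is a unit vector or is determined by the set `T` of its negative entries
(`face_eq_single_or_eq_neighborNormal`). In the first case there are at most `|V|` facets. In the
second `T` is nonempty and independent; since in a graph that is not bipartite a set and its
complement are never both independent, there are at most `2 ^ (|V| - 1) - 1` such `T`. In the
bipartite case `T` is a proper subset of the smaller side, which gives even fewer facets.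

For connected graphs that are not bipartite, facets correspond bijectively to `facetVectors G`.
For the windmill graph these vectors are listed according to their value at the centre
(`facetVectors_windmill`). A pendant vertex raises the dimension by one and loses no facet
(`encard_facetVectors_le_pendant`), which gives the lower bound in dimensions not divisible by three.
-/

namespace EdgePolytope

open Module Set

/-! ### Tight edges and the dimension of faces -/

section Linear

variable {V : Type*}

/-- The annihilator of the edges that `a` makes tight: all `b` with `b i + b j = 0` for every edge
`ij` of `G` with `a i + a j = 0`. For `a = 0` every edge is tight, and this is the annihilator of
the whole edge polytope. -/
def tightKer (G : SimpleGraph V) (a : V → ℝ) : Submodule ℝ (V → ℝ) where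
  carrier := {b | ∀ i j, G.Adj i j → a i + a j = 0 → b i + b j = 0}
  add_mem' {b c} hb hc i j h h0 := by
    have h1 := hb i j h h0
    have h2 := hc i j h h0
    simp only [Pi.add_apply]
    linarith
  zero_mem' i j _ _ := by simp
  smul_mem' t b hb i j h h0 := by
    have h1 := hb i j h h0
    simp only [Pi.smul_apply, smul_eq_mul]
    rw [← mul_add, h1, mul_zero]

theorem mem_tightKer {G : SimpleGraph V} {a b : V → ℝ} :
    b ∈ tightKer G a ↔ ∀ i j, G.Adj i j → a i + a j = 0 → b i + b j = 0 := Iff.rfl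

theorem mem_tightKer_zero {G : SimpleGraph V} {b : V → ℝ} :
    b ∈ tightKer G 0 ↔ ∀ i j, G.Adj i j → b i + b j = 0 := by
  simp [mem_tightKer]

theorem self_mem_tightKer (G : SimpleGraph V) (a : V → ℝ) : a ∈ tightKer G a :=
  fun _ _ _ h => h

theorem tightKer_zero_le (G : SimpleGraph V) (a : V → ℝ) : tightKer G 0 ≤ tightKer G a :=
  fun _ hb i j h _ => mem_tightKer_zero.1 hb i j h

theorem tightKer_congr {G : SimpleGraph V} {a b : V → ℝ}
    (h : ∀ i j, G.Adj i j → (a i + a j = 0 ↔ b i + b j = 0)) : tightKer G a = tightKer G b := by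
  ext c
  exact forall₂_congr fun i j => forall_congr' fun hij => by rw [h i j hij]

/-- `a` is a linear functional that is nonnegative on the edge polytope. -/
def IsSupporting (G : SimpleGraph V) (a : V → ℝ) : Prop :=
  ∀ i j, G.Adj i j → 0 ≤ a i + a j

variable [DecidableEq V]

/-- The vectors `e_i + e_j` of the edges `ij` with `a i + a j = 0`. -/
def tightSet (G : SimpleGraph V) (a : V → ℝ) : Set (V → ℝ) :=
  {x | ∃ i j : V, G.Adj i j ∧ a i + a j = 0 ∧ x = Pi.single i 1 + Pi.single j 1}

/-- The convex hull of the edge vectors annihilated by `a`. -/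
def face (G : SimpleGraph V) (a : V → ℝ) : Set (V → ℝ) :=
  convexHull ℝ (tightSet G a)

theorem edgePolytope_eq_face (G : SimpleGraph V) : edgePolytope G = face G 0 := by
  simp [edgePolytope, face, tightSet]

theorem face_congr {G : SimpleGraph V} {a b : V → ℝ}
    (h : ∀ i j, G.Adj i j → (a i + a j = 0 ↔ b i + b j = 0)) : face G a = face G b := by
  have : tightSet G a = tightSet G b := by
    ext x
    constructor
    · rintro ⟨i, j, hij, h0, rfl⟩
      exact ⟨i, j, hij, (h i j hij).1 h0, rfl⟩
    · rintro ⟨i, j, hij, h0, rfl⟩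
      exact ⟨i, j, hij, (h i j hij).2 h0, rfl⟩
  rw [face, face, this]

theorem face_subset_edgePolytope (G : SimpleGraph V) (a : V → ℝ) :
    face G a ⊆ edgePolytope G := by
  refine convexHull_mono ?_
  rintro _ ⟨i, j, hij, -, rfl⟩
  exact ⟨i, j, hij, rfl⟩

variable [Fintype V]

theorem dotProduct_edge (a : V → ℝ) (i j : V) :
    a ⬝ᵥ (Pi.single i 1 + Pi.single j 1 : V → ℝ) = a i + a j := by
  simp [dotProduct_add]

theorem mem_tightKer_iff_dotProduct {G : SimpleGraph V} {a b : V → ℝ} :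
    b ∈ tightKer G a ↔ ∀ x ∈ tightSet G a, b ⬝ᵥ x = 0 := by
  constructor
  · rintro h _ ⟨i, j, hij, h0, rfl⟩
    rw [dotProduct_edge]
    exact h i j hij h0
  · intro h i j hij h0
    rw [← dotProduct_edge]
    exact h _ ⟨i, j, hij, h0, rfl⟩

theorem finrank_span_tightSet (G : SimpleGraph V) (a : V → ℝ) :
    finrank ℝ (Submodule.span ℝ (tightSet G a)) + finrank ℝ (tightKer G a) = Fintype.card V := by
  have h := Subspace.finrank_add_finrank_dualAnnihilator_eq (Submodule.span ℝ (tightSet G a))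
  rw [finrank_fintype_fun_eq_card] at h
  rw [← h]
  congr 1
  have : (tightKer G a).map (dotProductEquiv ℝ V).toLinearMap =
      (Submodule.span ℝ (tightSet G a)).dualAnnihilator := by
    ext f
    obtain ⟨b, rfl⟩ := (dotProductEquiv ℝ V).surjective f
    rw [Submodule.mem_dualAnnihilator]
    constructor
    · rintro ⟨b', hb', h⟩
      obtain rfl := (dotProductEquiv ℝ V).injective h
      intro w hw
      induction hw using Submodule.span_induction with
      | mem x hx => exact mem_tightKer_iff_dotProduct.1 hb' x hx
      | zero => simp
      | add x y _ _ hx hy => rw [map_add, hx, hy, add_zero]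
      | smul t x _ hx => rw [map_smul, hx, smul_zero]
    · intro h
      exact ⟨b, mem_tightKer_iff_dotProduct.2 fun x hx => h x (Submodule.subset_span hx), rfl⟩
  rw [← this]
  exact (LinearEquiv.finrank_map_eq (dotProductEquiv ℝ V) _).symm

theorem sum_eq_two_of_mem_tightSet {G : SimpleGraph V} {a x : V → ℝ} (hx : x ∈ tightSet G a) :
    (1 : V → ℝ) ⬝ᵥ x = 2 := by
  obtain ⟨i, j, -, -, rfl⟩ := hx
  rw [dotProduct_edge]
  norm_num

/-- The edge vectors lie on a hyperplane that misses the origin, so passing from their linear span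
to their affine span lowers the dimension by one. -/
theorem finrank_span_eq_finrank_vectorSpan_add_one {G : SimpleGraph V} {a : V → ℝ}
    (h : (tightSet G a).Nonempty) :
    finrank ℝ (Submodule.span ℝ (tightSet G a)) = finrank ℝ (vectorSpan ℝ (tightSet G a)) + 1 := by
  obtain ⟨p, hp⟩ := h
  have hsum : ∀ y ∈ vectorSpan ℝ (tightSet G a), (1 : V → ℝ) ⬝ᵥ y = 0 := by
    intro y hy
    rw [vectorSpan_def] at hy
    induction hy using Submodule.span_induction with
    | mem x hx =>
      obtain ⟨u, hu, w, hw, rfl⟩ := hx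
      simp only [vsub_eq_sub, dotProduct_sub, sum_eq_two_of_mem_tightSet hu,
        sum_eq_two_of_mem_tightSet hw, sub_self]
    | zero => simp
    | add x y _ _ hx hy => rw [dotProduct_add, hx, hy, add_zero]
    | smul t x _ hx => rw [dotProduct_smul, hx, smul_zero]
  have hp2 := sum_eq_two_of_mem_tightSet hp
  have hspan : Submodule.span ℝ (tightSet G a) =
      vectorSpan ℝ (tightSet G a) ⊔ Submodule.span ℝ {p} := by
    apply le_antisymm
    · refine Submodule.span_le.2 fun x hx => ?_
      rw [show x = (x -ᵥ p) + p by simp]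
      exact Submodule.add_mem_sup (vsub_mem_vectorSpan ℝ hx hp)
        (Submodule.mem_span_singleton_self p)
    · refine sup_le ?_ (Submodule.span_mono (by simpa using hp))
      rw [vectorSpan_def]
      refine Submodule.span_le.2 ?_
      rintro _ ⟨u, hu, w, hw, rfl⟩
      exact Submodule.sub_mem _ (Submodule.subset_span hu) (Submodule.subset_span hw)
  have hinf : vectorSpan ℝ (tightSet G a) ⊓ Submodule.span ℝ {p} = ⊥ := by
    rw [eq_bot_iff]
    rintro y ⟨hy1, hy2⟩
    obtain ⟨t, rfl⟩ := Submodule.mem_span_singleton.1 hy2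
    have := hsum _ hy1
    rw [dotProduct_smul, hp2, smul_eq_mul] at this
    have ht : t = 0 := by linarith
    simp [ht]
  have hp0 : p ≠ 0 := by
    rintro rfl
    simp at hp2
  have := Submodule.finrank_sup_add_finrank_inf_eq (vectorSpan ℝ (tightSet G a))
    (Submodule.span ℝ {p})
  rw [← hspan, hinf, finrank_bot, finrank_span_singleton hp0] at this
  omega

/-- The dimension of the convex hull of the tight edges is governed by their annihilator. The
formula also covers the empty hull, of dimension `-1`. -/
theorem convexDim_face (G : SimpleGraph V) (a : V → ℝ) :
    convexDim (face G a) = (Fintype.card V : ℤ) - finrank ℝ (tightKer G a) - 1 := by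
  have h := finrank_span_tightSet G a
  by_cases hne : (tightSet G a).Nonempty
  · have h1 := finrank_span_eq_finrank_vectorSpan_add_one hne
    rw [convexDim, face, if_pos hne.convexHull, affineSpan_convexHull, direction_affineSpan]
    omega
  · have he := Set.not_nonempty_iff_eq_empty.1 hne
    rw [he, Submodule.span_empty, finrank_bot] at h
    rw [convexDim, face, he, convexHull_empty, if_neg (by simp)]
    omega

theorem convexDim_edgePolytope (G : SimpleGraph V) :
    convexDim (edgePolytope G) = (Fintype.card V : ℤ) - finrank ℝ (tightKer G 0) - 1 := by
  rw [edgePolytope_eq_face, convexDim_face]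

theorem dotProduct_nonneg_of_mem_edgePolytope {G : SimpleGraph V} {a : V → ℝ}
    (ha : IsSupporting G a) {x : V → ℝ} (hx : x ∈ edgePolytope G) : 0 ≤ a ⬝ᵥ x := by
  have hconv : Convex ℝ {x : V → ℝ | 0 ≤ a ⬝ᵥ x} := by
    refine convex_iff_forall_pos.2 fun x hx y hy s t hs ht _ => ?_
    simp only [mem_ofPred_eq] at *
    rw [dotProduct_add, dotProduct_smul, dotProduct_smul, smul_eq_mul, smul_eq_mul]
    positivity
  refine convexHull_min ?_ hconv hx
  rintro _ ⟨i, j, hij, rfl⟩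
  rw [mem_ofPred_eq, dotProduct_edge]
  exact ha i j hij

theorem dotProduct_eq_zero_of_mem_face {G : SimpleGraph V} {a : V → ℝ}
    {x : V → ℝ} (hx : x ∈ face G a) : a ⬝ᵥ x = 0 := by
  have hconv : Convex ℝ {x : V → ℝ | a ⬝ᵥ x = 0} := by
    refine convex_iff_forall_pos.2 fun x hx y hy s t hs ht _ => ?_
    simp only [mem_ofPred_eq] at *
    rw [dotProduct_add, dotProduct_smul, dotProduct_smul, hx, hy]
    simp
  refine convexHull_min ?_ hconv hx
  rintro _ ⟨i, j, hij, h0, rfl⟩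
  rw [mem_ofPred_eq, dotProduct_edge]
  exact h0

/-- The face cut out by a supporting functional is the convex hull of its tight edges. -/
theorem face_eq_of_isSupporting {G : SimpleGraph V} {a : V → ℝ} (ha : IsSupporting G a) :
    face G a = {x ∈ edgePolytope G | a ⬝ᵥ x = 0} := by
  refine Subset.antisymm (fun x hx => ⟨face_subset_edgePolytope G a hx,
    dotProduct_eq_zero_of_mem_face hx⟩) ?_
  -- The points that lie on the face or strictly off the supporting hyperplane form a convex set.
  have hconv : Convex ℝ (face G a ∪ {x : V → ℝ | 0 < a ⬝ᵥ x}) := by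
    refine convex_iff_forall_pos.2 fun x hx y hy s t hs ht hst => ?_
    rcases hx with hx | hx <;> rcases hy with hy | hy
    · exact Or.inl (convex_convexHull ℝ _ hx hy hs.le ht.le hst)
    all_goals
      right
      simp only [mem_ofPred_eq] at *
      rw [dotProduct_add, dotProduct_smul, dotProduct_smul, smul_eq_mul, smul_eq_mul]
      first
        | rw [dotProduct_eq_zero_of_mem_face hx]; positivity
        | rw [dotProduct_eq_zero_of_mem_face hy]; positivity
        | positivity
  rintro x ⟨hx, h0⟩
  have : x ∈ face G a ∪ {x : V → ℝ | 0 < a ⬝ᵥ x} := by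
    refine convexHull_min ?_ hconv hx
    rintro _ ⟨i, j, hij, rfl⟩
    rcases (ha i j hij).eq_or_lt with h | h
    · exact Or.inl (subset_convexHull ℝ _ ⟨i, j, hij, h.symm, rfl⟩)
    · right
      rw [mem_ofPred_eq, dotProduct_edge]
      exact h
  rcases this with h | h
  · exact h
  · exact absurd h0 (ne_of_gt h)

/-- Facets are the faces of the supporting functionals whose tight edges have an annihilator of
dimension one more than that of all edges. -/
theorem isFacet_edgePolytope_iff {G : SimpleGraph V} (hdim : 0 < convexDim (edgePolytope G))
    {F : Set (V → ℝ)} :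
    IsFacet (edgePolytope G) F ↔ ∃ a, IsSupporting G a ∧
      finrank ℝ (tightKer G a) = finrank ℝ (tightKer G 0) + 1 ∧ F = face G a := by
  have hP := convexDim_edgePolytope G
  constructor
  · rintro ⟨hexp, hF⟩
    have hne : F.Nonempty := by
      by_contra hne
      rw [convexDim, if_neg hne] at hF
      omega
    obtain ⟨l, hl⟩ := hexp hne
    obtain ⟨x₀, hx₀⟩ := hne
    -- Subtracting `l` from its maximum, which is linear on the hyperplane `∑ x = 2`.
    set a : V → ℝ := fun v => l x₀ / 2 - l (Pi.single v 1) with ha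
    have key : ∀ x ∈ edgePolytope G, a ⬝ᵥ x = l x₀ - l x := by
      have hconv : Convex ℝ {x : V → ℝ | a ⬝ᵥ x = l x₀ - l x} := by
        refine convex_iff_forall_pos.2 fun x hx y hy s t hs ht hst => ?_
        simp only [mem_ofPred_eq] at *
        rw [dotProduct_add, dotProduct_smul, dotProduct_smul, hx, hy, map_add, map_smul, map_smul]
        simp only [smul_eq_mul]
        linear_combination (l x₀) * hst
      refine fun x hx => convexHull_min ?_ hconv hx
      rintro _ ⟨i, j, hij, rfl⟩
      rw [mem_ofPred_eq, dotProduct_edge, map_add, ha]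
      ring
    have hx₀' := hx₀
    rw [hl] at hx₀'
    have hsupp : IsSupporting G a := by
      intro i j hij
      have hmem : (Pi.single i 1 + Pi.single j 1 : V → ℝ) ∈ edgePolytope G :=
        subset_convexHull ℝ _ ⟨i, j, hij, rfl⟩
      rw [← dotProduct_edge, key _ hmem]
      linarith [hx₀'.2 _ hmem]
    have hFa : F = face G a := by
      rw [face_eq_of_isSupporting hsupp, hl]
      ext x
      refine and_congr_right fun hx => ?_
      rw [key x hx]
      constructor
      · intro h
        linarith [h x₀ hx₀'.1, hx₀'.2 x hx]
      · intro h y hy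
        linarith [hx₀'.2 y hy]
    refine ⟨a, hsupp, ?_, hFa⟩
    rw [hFa, convexDim_face, hP] at hF
    omega
  · rintro ⟨a, hsupp, hrank, rfl⟩
    refine ⟨?_, by rw [convexDim_face, hP]; omega⟩
    rintro ⟨x₀, hx₀⟩
    refine ⟨-(LinearMap.toContinuousLinearMap (dotProductEquiv ℝ V a)), ?_⟩
    rw [face_eq_of_isSupporting hsupp] at hx₀ ⊢
    ext x
    refine and_congr_right fun hx => ?_
    simp only [neg_apply, LinearMap.coe_toContinuousLinearMap',
      dotProductEquiv_apply_apply, neg_le_neg_iff]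
    constructor
    · intro h y hy
      rw [h]
      exact dotProduct_nonneg_of_mem_edgePolytope hsupp hy
    · intro h
      refine le_antisymm ?_ (dotProduct_nonneg_of_mem_edgePolytope hsupp hx)
      rw [← hx₀.2]
      exact h x₀ hx₀.1

end Linear

/-! ### Normal vectors with entries in `{-1, 0, 1}` -/

section Sign

variable {V : Type*} {G : SimpleGraph V} {a b c : V → ℝ}

/-- All entries of `a` are `-1`, `0` or `1`. -/
def IsSignVector (a : V → ℝ) : Prop :=
  ∀ v, a v = -1 ∨ a v = 0 ∨ a v = 1

theorem not_mem_tightKer_zero_of_finrank_eq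
    (hrank : finrank ℝ (tightKer G a) = finrank ℝ (tightKer G 0) + 1) : a ∉ tightKer G 0 := by
  intro h
  have : tightKer G a = tightKer G 0 := tightKer_congr fun i j hij => by
    simp [mem_tightKer_zero.1 h i j hij]
  rw [this] at hrank
  omega

theorem exists_adj_add_pos (ha : IsSupporting G a) (h : a ∉ tightKer G 0) :
    ∃ i j, G.Adj i j ∧ 0 < a i + a j := by
  by_contra! hcon
  exact h (mem_tightKer_zero.2 fun i j hij => le_antisymm (hcon i j hij) (ha i j hij))

/-- If the annihilator of the tight edges is only one dimension larger than that of all edges, then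
any of its elements is a multiple of a given one, modulo the annihilator of all edges. -/
theorem exists_sub_smul_mem [Finite V]
    (hrank : finrank ℝ (tightKer G a) = finrank ℝ (tightKer G 0) + 1)
    (hc : c ∈ tightKer G a) (hc0 : c ∉ tightKer G 0) (hb : b ∈ tightKer G a) :
    ∃ t : ℝ, b - t • c ∈ tightKer G 0 := by
  have hle : tightKer G 0 ⊔ Submodule.span ℝ {c} ≤ tightKer G a :=
    sup_le (tightKer_zero_le G a) (by simpa using hc)
  have hlt : tightKer G 0 < tightKer G 0 ⊔ Submodule.span ℝ {c} := by
    refine lt_of_le_of_ne le_sup_left fun h => hc0 ?_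
    rw [h]
    exact Submodule.mem_sup_right (Submodule.mem_span_singleton_self c)
  have heq : tightKer G 0 ⊔ Submodule.span ℝ {c} = tightKer G a := by
    have := Submodule.finrank_lt_finrank_of_lt hlt
    exact Submodule.eq_of_le_of_finrank_le hle (by omega)
  rw [← heq] at hb
  obtain ⟨y, hy, z, hz, rfl⟩ := Submodule.mem_sup.1 hb
  obtain ⟨t, rfl⟩ := Submodule.mem_span_singleton.1 hz
  exact ⟨t, by simpa using hy⟩

theorem add_eq_mul_of_sub_smul_mem {t : ℝ} (h : b - t • a ∈ tightKer G 0) {i j : V}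
    (hij : G.Adj i j) : b i + b j = t * (a i + a j) := by
  have := mem_tightKer_zero.1 h i j hij
  simp only [Pi.sub_apply, Pi.smul_apply, smul_eq_mul] at this
  linarith

theorem tight_iff_of_sub_smul_mem {t : ℝ} (ht : t ≠ 0) (h : b - t • a ∈ tightKer G 0) (i j : V)
    (hij : G.Adj i j) : b i + b j = 0 ↔ a i + a j = 0 := by
  rw [add_eq_mul_of_sub_smul_mem h hij]
  simp [ht]

theorem IsSupporting.of_sub_smul_mem {t : ℝ} (ha : IsSupporting G a) (ht : 0 < t)
    (h : b - t • a ∈ tightKer G 0) : IsSupporting G b := by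
  intro i j hij
  rw [add_eq_mul_of_sub_smul_mem h hij]
  exact mul_nonneg ht.le (ha i j hij)

/-- When no nonzero functional vanishes on all edges, every facet normal is a positive multiple of a
vector with entries in `{-1, 0, 1}`: the entrywise sign of the normal vanishes on the same edges,
so it is proportional to the normal. -/
theorem exists_isSignVector_smul [Finite V] (hG : tightKer G 0 = ⊥)
    (hrank : finrank ℝ (tightKer G a) = finrank ℝ (tightKer G 0) + 1) :
    ∃ b : V → ℝ, ∃ t : ℝ, 0 < t ∧ IsSignVector b ∧ b = t • a := by
  have ha0 := not_mem_tightKer_zero_of_finrank_eq hrank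
  have hb : (fun v => Real.sign (a v)) ∈ tightKer G a := by
    intro i j _ h0
    have : a i = -a j := by linarith
    simp only [this, Real.sign_neg]
    ring
  obtain ⟨t, ht⟩ := exists_sub_smul_mem hrank (self_mem_tightKer G a) ha0 hb
  rw [hG, Submodule.mem_bot, sub_eq_zero] at ht
  refine ⟨_, t, ?_, ?_, ht⟩
  · rw [hG, Submodule.mem_bot] at ha0
    obtain ⟨v, hv⟩ := Function.ne_iff.1 ha0
    have hv' := congrFun ht v
    simp only [Pi.smul_apply, smul_eq_mul] at hv'
    rcases lt_or_gt_of_ne hv with h | h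
    · rw [Real.sign_of_neg h] at hv'
      simp only [Pi.zero_apply] at h
      by_contra! hcon
      nlinarith
    · rw [Real.sign_of_pos h] at hv'
      simp only [Pi.zero_apply] at h
      by_contra! hcon
      nlinarith
  · intro v
    exact Real.sign_apply_eq (a v)

/-- For a bipartite graph with signing `ε` of its two sides, the normal of a facet can be changed,
modulo `ε` and a positive factor, to a vector that takes values in `{-1, 0}` on the positive side
and in `{0, 1}` on the negative side. Along tight edges `ε v * a v` is constant, so thresholding
this function gives another element of the annihilator. -/
theorem exists_isSignVector_of_bipartite [Finite V] {ε : V → ℝ} (hε : ∀ v, ε v = 1 ∨ ε v = -1)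
    (hεK : ε ∈ tightKer G 0) (ha : IsSupporting G a)
    (hrank : finrank ℝ (tightKer G a) = finrank ℝ (tightKer G 0) + 1) :
    ∃ b : V → ℝ, ∃ t : ℝ, 0 < t ∧ b - t • a ∈ tightKer G 0 ∧ IsSignVector b ∧
      (∀ v, b v = -1 → ε v = 1) ∧ ∃ v, ε v = 1 ∧ b v ≠ -1 := by
  have ha0 := not_mem_tightKer_zero_of_finrank_eq hrank
  have hεadj := mem_tightKer_zero.1 hεK
  obtain ⟨i, j, hij, hpos, hi⟩ : ∃ i j, G.Adj i j ∧ 0 < a i + a j ∧ ε i = 1 := by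
    obtain ⟨i, j, hij, hpos⟩ := exists_adj_add_pos ha ha0
    rcases hε i with h | h
    · exact ⟨i, j, hij, hpos, h⟩
    · exact ⟨j, i, hij.symm, by linarith, by linarith [hεadj i j hij]⟩
  have hj : ε j = -1 := by linarith [hεadj i j hij]
  classical
  set b : V → ℝ := fun v => if ε v * a v < a i then -ε v else 0 with hbdef
  have hb : b ∈ tightKer G a := by
    intro u w huw h0
    have h1 : ε u = -ε w := by linarith [hεadj u w huw]
    have h2 : a u = -a w := by linarith
    simp only [hbdef, h1, h2, neg_mul_neg]
    split_ifs <;> ring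
  obtain ⟨t, ht⟩ := exists_sub_smul_mem hrank (self_mem_tightKer G a) ha0 hb
  have hbi : b i = 0 := by simp [hbdef, hi]
  have hbj : b j = 1 := by
    have : -a j < a i := by linarith
    simp [hbdef, hj, this]
  refine ⟨b, t, ?_, ht, ?_, ?_, i, hi, by rw [hbi]; norm_num⟩
  · have := add_eq_mul_of_sub_smul_mem ht hij
    rw [hbi, hbj, zero_add] at this
    exact pos_of_mul_pos_left (by rw [← this]; norm_num) hpos.le
  · intro v
    simp only [hbdef]
    rcases hε v with h | h <;> split_ifs <;> simp [h]
  · intro v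
    simp only [hbdef]
    rcases hε v with h | h <;> split_ifs <;> norm_num [h]

open Classical in
/-- The vector that is `-1` on `T`, `1` on the neighbours of `T` outside `T`, and `0` elsewhere: the
normal of the inequality `∑_{T} x ≤ ∑_{N(T)} x`. -/
noncomputable def neighborNormal (G : SimpleGraph V) (T : Finset V) (v : V) : ℝ :=
  if v ∈ T then -1 else if ∃ w ∈ T, G.Adj v w then 1 else 0

/-- A facet with a normal in `{-1, 0, 1}` either consists of the edges that avoid some vertex, or
the normal is determined by the set of its negative entries: a positive entry
without negative neighbour would make the unit vector there vanish on the tight edges. -/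
theorem face_eq_single_or_eq_neighborNormal [Fintype V] [DecidableEq V]
    (hiso : ∀ v, ∃ w, G.Adj v w) (hs : IsSignVector a) (ha : IsSupporting G a)
    (hrank : finrank ℝ (tightKer G a) = finrank ℝ (tightKer G 0) + 1) :
    (∃ v, face G a = face G (Pi.single v 1)) ∨
      ∃ T : Finset V, T.Nonempty ∧ (∀ v, v ∈ T ↔ a v = -1) ∧ a = neighborNormal G T := by
  have ha0 := not_mem_tightKer_zero_of_finrank_eq hrank
  by_cases hex : ∃ s, a s = 1 ∧ ∀ w, G.Adj s w → a w ≠ -1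
  · left
    obtain ⟨s, hs1, hsw⟩ := hex
    refine ⟨s, ?_⟩
    have hmem : (Pi.single s 1 : V → ℝ) ∈ tightKer G a := by
      intro i j hij h0
      have hi : i ≠ s := by
        rintro rfl
        exact hsw j hij (by linarith)
      have hj : j ≠ s := by
        rintro rfl
        exact hsw i hij.symm (by linarith)
      simp [hi, hj]
    obtain ⟨w, hw⟩ := hiso s
    have hnot : (Pi.single s 1 : V → ℝ) ∉ tightKer G 0 := by
      intro h
      have := mem_tightKer_zero.1 h s w hw
      simp [hw.ne'] at this
    obtain ⟨t, ht⟩ := exists_sub_smul_mem hrank hmem hnot (self_mem_tightKer G a)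
    refine face_congr (tight_iff_of_sub_smul_mem ?_ ht)
    rintro rfl
    have h1 := add_eq_mul_of_sub_smul_mem ht hw
    exact hsw w hw (by linarith)
  · right
    push Not at hex
    classical
    have hT : ∀ v, v ∈ Finset.univ.filter (fun v => a v = -1) ↔ a v = -1 := by simp
    refine ⟨Finset.univ.filter fun v => a v = -1, ?_, hT, ?_⟩
    · have hne : a ≠ 0 := fun h => ha0 (by rw [h]; exact zero_mem _)
      obtain ⟨v, hv⟩ := Function.ne_iff.1 hne
      rcases hs v with h | h | h
      · exact ⟨v, (hT v).2 h⟩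
      · exact absurd h hv
      · obtain ⟨w, -, hw⟩ := hex v h
        exact ⟨w, (hT w).2 hw⟩
    · ext v
      simp only [neighborNormal, hT]
      split_ifs with h1 h2
      · exact h1
      · obtain ⟨w, hw, hvw⟩ := h2
        have := ha v w hvw
        rcases hs v with h | h | h
        · exact absurd h h1
        · linarith
        · exact h
      · rcases hs v with h | h | h
        · exact absurd h h1
        · exact h
        · obtain ⟨w, hvw, hw⟩ := hex v h
          exact absurd ⟨w, hw, hvw⟩ h2

/-- A connected graph is annihilated only by `0`, or by the multiples of a signing. -/
theorem tightKer_zero_eq_bot_or_exists_signing (hG : G.Connected) :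
    tightKer G 0 = ⊥ ∨ ∃ ε : V → ℝ, (∀ v, ε v = 1 ∨ ε v = -1) ∧ ε ∈ tightKer G 0 ∧
      tightKer G 0 = Submodule.span ℝ {ε} := by
  have hconst : ∀ f : V → ℝ, (∀ i j, G.Adj i j → f i = f j) → ∀ u v, f u = f v := by
    intro f hf u v
    obtain ⟨p⟩ := hG.preconnected u v
    induction p with
    | nil => rfl
    | cons h _ ih => exact (hf _ _ h).trans ih
  by_cases hbot : tightKer G 0 = ⊥
  · exact Or.inl hbot
  right
  obtain ⟨b, hb, hb0⟩ := Submodule.exists_mem_ne_zero_of_ne_bot hbot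
  have hb' := mem_tightKer_zero.1 hb
  obtain ⟨u, hu⟩ := Function.ne_iff.1 hb0
  simp only [Pi.zero_apply] at hu
  have habs : ∀ v, b v ^ 2 = b u ^ 2 := fun v => hconst (fun v => b v ^ 2) (fun i j hij => by
    have : b i = -b j := by linarith [hb' i j hij]
    simp only [this, neg_sq]) v u
  have hε : (b u)⁻¹ • b ∈ tightKer G 0 := Submodule.smul_mem _ _ hb
  have hsign : ∀ v, ((b u)⁻¹ • b) v = 1 ∨ ((b u)⁻¹ • b) v = -1 := by
    intro v
    rw [← sq_eq_one_iff]
    simp only [Pi.smul_apply, smul_eq_mul, mul_pow, habs v, inv_pow]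
    exact inv_mul_cancel₀ (pow_ne_zero 2 hu)
  refine ⟨_, hsign, hε, ?_⟩
  refine le_antisymm ?_ (by rw [Submodule.span_le]; simpa using hε)
  generalize (b u)⁻¹ • b = ε at hε hsign
  have hε' := mem_tightKer_zero.1 hε
  intro c hc
  refine Submodule.mem_span_singleton.2 ⟨ε u * c u, ?_⟩
  ext v
  have h1 := hconst (fun v => ε v * c v) (fun i j hij => by
    have h1 : ε i = -ε j := by linarith [hε' i j hij]
    have h2 : c i = -c j := by linarith [mem_tightKer_zero.1 hc i j hij]
    simp only [h1, h2, neg_mul_neg]) u v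
  simp only [Pi.smul_apply, smul_eq_mul] at h1 ⊢
  rw [h1]
  rcases hsign v with h | h <;> rw [h] <;> ring

end Sign

/-! ### The upper bound -/

section UpperBound

variable {V : Type*} [Fintype V] {G : SimpleGraph V}

theorem exists_adj_of_connected (hG : G.Connected) (hV : 2 ≤ Fintype.card V) (v : V) :
    ∃ w, G.Adj v w :=
  have : Nontrivial V := Fintype.one_lt_card_iff_nontrivial.1 hV
  hG.preconnected.exists_adj_of_nontrivial v

variable [DecidableEq V]

theorem numFacets_le_of_forall (𝓣 : Finset (Finset V))
    (h : ∀ F, IsFacet (edgePolytope G) F → (∃ v, F = face G (Pi.single v 1)) ∨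
      ∃ T ∈ 𝓣, F = face G (neighborNormal G T)) :
    numFacets (edgePolytope G) ≤ ((Fintype.card V + 𝓣.card : ℕ) : ℕ∞) := by
  have hsub : {F | IsFacet (edgePolytope G) F} ⊆
      (fun v : V => face G (Pi.single v 1)) '' univ ∪
        (fun T => face G (neighborNormal G T)) '' (𝓣 : Set (Finset V)) := by
    intro F hF
    rcases h F hF with ⟨v, rfl⟩ | ⟨T, hT, rfl⟩
    · exact Or.inl ⟨v, mem_univ v, rfl⟩
    · exact Or.inr ⟨T, hT, rfl⟩
  refine (encard_le_encard hsub).trans ((encard_union_le _ _).trans ?_)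
  rw [Nat.cast_add]
  refine add_le_add ((encard_image_le _ _).trans ?_) ((encard_image_le _ _).trans ?_)
  · simp
  · simp

/-- A set and its complement cannot both be independent in a graph that is not bipartite, so at most
half of all subsets are independent. -/
theorem card_independent_le (hG : tightKer G 0 = ⊥) [Nonempty V] (𝓣 : Finset (Finset V))
    (h𝓣 : ∀ T ∈ 𝓣, ∀ u ∈ T, ∀ v ∈ T, ¬ G.Adj u v) :
    2 * 𝓣.card ≤ 2 ^ Fintype.card V := by
  have hdisj : Disjoint 𝓣 (𝓣.image compl) := by
    rw [Finset.disjoint_left]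
    intro T hT hT'
    obtain ⟨S, hS, rfl⟩ := Finset.mem_image.1 hT'
    have hmem : (fun v => if v ∈ S then 1 else -1 : V → ℝ) ∈ tightKer G 0 := by
      refine mem_tightKer_zero.2 fun i j hij => ?_
      have h1 := h𝓣 S hS i
      have h2 := h𝓣 _ hT i
      simp only [Finset.mem_compl] at h2
      by_cases hi : i ∈ S <;> by_cases hj : j ∈ S
      · exact absurd hij (h1 hi j hj)
      · simp [hi, hj]
      · simp [hi, hj]
      · exact absurd hij (h2 hi j hj)
    rw [hG, Submodule.mem_bot] at hmem
    have := congrFun hmem (Classical.arbitrary V)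
    simp only [Pi.zero_apply] at this
    split_ifs at this <;> norm_num at this
  have hcard := Finset.card_le_univ (𝓣 ∪ 𝓣.image compl)
  rw [Finset.card_union_of_disjoint hdisj, Finset.card_image_of_injective _ compl_injective,
    Fintype.card_finset] at hcard
  omega

theorem numFacets_le_of_tightKer_eq_bot (hiso : ∀ v, ∃ w, G.Adj v w) (hG : tightKer G 0 = ⊥)
    {d : ℕ} (hd : 0 < d) (hV : Fintype.card V = d + 1) :
    numFacets (edgePolytope G) ≤ ((2 ^ d + d : ℕ) : ℕ∞) := by
  classical
  have : Nonempty V := Fintype.card_pos_iff.1 (by omega)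
  have hdim : 0 < convexDim (edgePolytope G) := by
    rw [convexDim_edgePolytope, hG, finrank_bot, hV]
    push_cast
    omega
  let 𝓣 : Finset (Finset V) := Finset.univ.filter fun T =>
    T.Nonempty ∧ ∀ u ∈ T, ∀ v ∈ T, ¬ G.Adj u v
  have hle := numFacets_le_of_forall (G := G) 𝓣 (by
    intro F hF
    obtain ⟨a, ha, hrank, rfl⟩ := (isFacet_edgePolytope_iff hdim).1 hF
    obtain ⟨b, t, ht, hb, hbt⟩ := exists_isSignVector_smul hG hrank
    have hmem : b - t • a ∈ tightKer G 0 := by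
      rw [hbt, sub_self]
      exact zero_mem _
    have htight := tight_iff_of_sub_smul_mem ht.ne' hmem
    have hbs := ha.of_sub_smul_mem ht hmem
    rw [← tightKer_congr htight] at hrank
    rw [← face_congr htight]
    rcases face_eq_single_or_eq_neighborNormal hiso hb hbs hrank with ⟨v, hv⟩ | ⟨T, hT, hTb, hbT⟩
    · exact Or.inl ⟨v, hv⟩
    · refine Or.inr ⟨T, ?_, by rw [← hbT]⟩
      simp only [𝓣, Finset.mem_filter, Finset.mem_univ, true_and]
      refine ⟨hT, fun u hu v hv huv => ?_⟩
      have := hbs u v huv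
      rw [(hTb u).1 hu, (hTb v).1 hv] at this
      norm_num at this)
  have hcount := card_independent_le hG (insert ∅ 𝓣) (by
    intro T hT
    rcases Finset.mem_insert.1 hT with rfl | hT
    · simp
    · exact (Finset.mem_filter.1 hT).2.2)
  rw [Finset.card_insert_of_notMem (by simp [𝓣]), hV, pow_succ] at hcount
  exact hle.trans (Nat.cast_le.2 (by omega))

theorem numFacets_le_of_signing (hiso : ∀ v, ∃ w, G.Adj v w) {ε : V → ℝ}
    (hε : ∀ v, ε v = 1 ∨ ε v = -1) (hK : tightKer G 0 = Submodule.span ℝ {ε})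
    (S : Finset V) (hS : ∀ v, v ∈ S ↔ ε v = 1) (hhalf : 2 * S.card ≤ Fintype.card V)
    {d : ℕ} (hd : 2 ≤ d) (hV : Fintype.card V = d + 2) :
    numFacets (edgePolytope G) ≤ ((2 ^ d + d : ℕ) : ℕ∞) := by
  classical
  have hεK : ε ∈ tightKer G 0 := by
    rw [hK]
    exact Submodule.mem_span_singleton_self ε
  have hfin : finrank ℝ (tightKer G 0) ≤ 1 := by
    rw [hK]
    exact (finrank_span_le_card ({ε} : Set (V → ℝ))).trans (by simp)
  have hdim : 0 < convexDim (edgePolytope G) := by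
    rw [convexDim_edgePolytope, hV]
    push_cast
    omega
  have hle := numFacets_le_of_forall (G := G) ((S.powerset.erase S).erase ∅) (by
    intro F hF
    obtain ⟨a, ha, hrank, rfl⟩ := (isFacet_edgePolytope_iff hdim).1 hF
    obtain ⟨b, t, ht, hmem, hb, hb1, u, hu1, hu⟩ :=
      exists_isSignVector_of_bipartite hε hεK ha hrank
    have htight := tight_iff_of_sub_smul_mem ht.ne' hmem
    have hbs := ha.of_sub_smul_mem ht hmem
    rw [← tightKer_congr htight] at hrank
    rw [← face_congr htight]
    rcases face_eq_single_or_eq_neighborNormal hiso hb hbs hrank with ⟨v, hv⟩ | ⟨T, hT, hTb, hbT⟩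
    · exact Or.inl ⟨v, hv⟩
    · refine Or.inr ⟨T, ?_, by rw [← hbT]⟩
      refine Finset.mem_erase.2 ⟨hT.ne_empty, Finset.mem_erase.2 ⟨?_, Finset.mem_powerset.2
        fun v hv => (hS v).2 (hb1 v ((hTb v).1 hv))⟩⟩
      rintro rfl
      exact hu ((hTb u).1 ((hS u).2 hu1)))
  refine hle.trans (Nat.cast_le.2 ?_)
  have h2 : 2 ^ S.card ≤ 2 ^ d := Nat.pow_le_pow_right (by norm_num) (by omega)
  have h4 : 2 ^ 2 ≤ 2 ^ d := Nat.pow_le_pow_right (by norm_num) hd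
  rcases S.eq_empty_or_nonempty with rfl | hne
  · simp only [Finset.powerset_empty, Finset.erase_singleton, Finset.erase_empty,
      Finset.card_empty]
    omega
  · rw [Finset.card_erase_of_mem (Finset.mem_erase.2 ⟨hne.ne_empty.symm,
      Finset.empty_mem_powerset S⟩), Finset.card_erase_of_mem (Finset.mem_powerset_self S),
      Finset.card_powerset]
    omega

theorem numFacets_edgePolytope_le (hG : G.Connected) {d : ℕ} (hd : 3 ≤ d)
    (hdim : convexDim (edgePolytope G) = d) :
    numFacets (edgePolytope G) ≤ ((2 ^ d + d : ℕ) : ℕ∞) := by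
  classical
  rw [convexDim_edgePolytope] at hdim
  have hiso := exists_adj_of_connected hG (by omega)
  rcases tightKer_zero_eq_bot_or_exists_signing hG with hK | ⟨ε, hε, hεK, hK⟩
  · rw [hK, finrank_bot] at hdim
    exact numFacets_le_of_tightKer_eq_bot hiso hK (by omega) (by omega)
  · have hε0 : ε ≠ 0 := by
      rintro rfl
      have : Nonempty V := hG.nonempty
      have := hε (Classical.arbitrary V)
      norm_num at this
    rw [hK, finrank_span_singleton hε0] at hdim
    -- The signing is chosen to be positive on the smaller side.
    let S : Finset V := Finset.univ.filter fun v => ε v = 1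
    have hS : ∀ v, v ∈ S ↔ ε v = 1 := by simp [S]
    have hcard := Finset.card_add_card_compl S
    by_cases hhalf : 2 * S.card ≤ Fintype.card V
    · exact numFacets_le_of_signing hiso hε hK S hS hhalf (by omega) (by omega)
    · refine numFacets_le_of_signing hiso (ε := -ε) ?_ ?_ Sᶜ ?_ (by omega) (by omega) (by omega)
      · intro v
        rcases hε v with h | h <;> simp [h]
      · rw [hK, ← Set.neg_singleton, Submodule.span_neg]
      · intro v
        rw [Finset.mem_compl, hS]
        rcases hε v with h | h <;> norm_num [h]

end UpperBound

/-! ### Facets as combinatorial objects -/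

section FacetVectors

variable {V : Type*} {G : SimpleGraph V}

/-- The nonzero `{-1, 0, 1}`-vectors that are nonnegative on all edges and span the annihilator of
their tight edges. For a connected graph that is not bipartite these are the facet normals. -/
def facetVectors (G : SimpleGraph V) : Set (V → ℝ) :=
  {a | IsSignVector a ∧ a ≠ 0 ∧ IsSupporting G a ∧ ∀ b ∈ tightKer G a, ∃ t : ℝ, b = t • a}

theorem finrank_tightKer_eq_one {a : V → ℝ} (ha : a ∈ facetVectors G) :
    finrank ℝ (tightKer G a) = 1 := by
  have : tightKer G a = Submodule.span ℝ {a} := by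
    refine le_antisymm (fun b hb => ?_)
      (by rw [Submodule.span_le]; simpa using self_mem_tightKer G a)
    obtain ⟨t, rfl⟩ := ha.2.2.2 b hb
    exact Submodule.smul_mem _ _ (Submodule.mem_span_singleton_self a)
  rw [this, finrank_span_singleton ha.2.1]

/-- If `-a` were also a supporting functional, `a` would vanish on every edge. -/
theorem eq_of_mem_facetVectors_of_mem_tightKer (hG : tightKer G 0 = ⊥) {a b : V → ℝ}
    (ha : a ∈ facetVectors G) (hb : b ∈ facetVectors G) (h : b ∈ tightKer G a) : b = a := by
  obtain ⟨t, rfl⟩ := ha.2.2.2 b h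
  have hne := hb.2.1
  obtain ⟨v, hv⟩ := Function.ne_iff.1 hne
  simp only [Pi.smul_apply, smul_eq_mul, Pi.zero_apply] at hv
  have hsq : t ^ 2 = 1 := by
    have h1 := ha.1 v
    have h2 := hb.1 v
    simp only [Pi.smul_apply, smul_eq_mul] at h2
    rcases h1 with h1 | h1 | h1 <;> rw [h1] at h2 hv
    · rcases h2 with h2 | h2 | h2
      · nlinarith
      · exact absurd h2 hv
      · nlinarith
    · simp at hv
    · rcases h2 with h2 | h2 | h2
      · nlinarith
      · exact absurd h2 hv
      · nlinarith
  rcases sq_eq_one_iff.1 hsq with rfl | rfl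
  · rw [one_smul]
  · refine absurd ?_ ha.2.1
    rw [← Submodule.mem_bot ℝ, ← hG]
    refine mem_tightKer_zero.2 fun i j hij => le_antisymm ?_ (ha.2.2.1 i j hij)
    have := hb.2.2.1 i j hij
    simp only [Pi.smul_apply, smul_eq_mul] at this
    linarith

theorem numFacets_eq_encard_facetVectors [Fintype V] [DecidableEq V] (hG : tightKer G 0 = ⊥)
    (hV : 2 ≤ Fintype.card V) : numFacets (edgePolytope G) = (facetVectors G).encard := by
  have hdim : 0 < convexDim (edgePolytope G) := by
    rw [convexDim_edgePolytope, hG, finrank_bot]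
    omega
  have hinj : InjOn (face G) (facetVectors G) := by
    intro a ha b hb hab
    refine (eq_of_mem_facetVectors_of_mem_tightKer hG ha hb ?_).symm
    refine mem_tightKer_iff_dotProduct.2 fun x hx =>
      dotProduct_eq_zero_of_mem_face (G := G) ?_
    rw [← hab]
    exact subset_convexHull ℝ _ hx
  rw [numFacets, ← hinj.encard_image]
  congr 1
  ext F
  rw [mem_ofPred_eq, isFacet_edgePolytope_iff hdim]
  constructor
  · rintro ⟨a, ha, hrank, rfl⟩
    have ha0 := not_mem_tightKer_zero_of_finrank_eq hrank
    obtain ⟨b, t, ht, hb, hbt⟩ := exists_isSignVector_smul hG hrank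
    have hmem : b - t • a ∈ tightKer G 0 := by
      rw [hbt, sub_self]
      exact zero_mem _
    have htight := tight_iff_of_sub_smul_mem ht.ne' hmem
    have hbs := ha.of_sub_smul_mem ht hmem
    rw [← tightKer_congr htight] at hrank
    refine ⟨b, ⟨hb, ?_, hbs, ?_⟩, face_congr htight⟩
    · rintro rfl
      exact not_mem_tightKer_zero_of_finrank_eq hrank (zero_mem _)
    · intro c hc
      obtain ⟨s, hs⟩ := exists_sub_smul_mem hrank (self_mem_tightKer G b)
        (not_mem_tightKer_zero_of_finrank_eq hrank) hc
      rw [hG, Submodule.mem_bot, sub_eq_zero] at hs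
      exact ⟨s, hs⟩
  · rintro ⟨a, ha, rfl⟩
    exact ⟨a, ha.2.2.1, by rw [finrank_tightKer_eq_one ha, hG, finrank_bot], rfl⟩

/-- A graph isomorphism carries facet vectors to facet vectors. -/
theorem comp_mem_facetVectors {W : Type*} {H : SimpleGraph W} (φ : H ≃g G) {a : V → ℝ}
    (ha : a ∈ facetVectors G) : a ∘ φ ∈ facetVectors H := by
  obtain ⟨h1, h2, h3, h4⟩ := ha
  refine ⟨fun w => h1 _, fun h => h2 ?_, fun i j hij => h3 _ _ (φ.map_adj_iff.2 hij), ?_⟩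
  · ext v
    simpa using congrFun h (φ.symm v)
  · intro b hb
    obtain ⟨t, ht⟩ := h4 (b ∘ φ.symm) fun i j hij h0 =>
      hb _ _ (φ.symm.map_adj_iff.2 hij) (by simpa using h0)
    refine ⟨t, ?_⟩
    ext w
    simpa using congrFun ht (φ w)

theorem tightKer_zero_eq_bot_of_iso {W : Type*} {H : SimpleGraph W} (φ : H ≃g G)
    (hG : tightKer G 0 = ⊥) : tightKer H 0 = ⊥ := by
  rw [eq_bot_iff]
  intro b hb
  have : b ∘ φ.symm ∈ tightKer G 0 := mem_tightKer_zero.2 fun i j hij =>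
    mem_tightKer_zero.1 hb _ _ (φ.symm.map_adj_iff.2 hij)
  rw [hG, Submodule.mem_bot] at this
  rw [Submodule.mem_bot]
  ext w
  simpa using congrFun this (φ w)

theorem exists_mem_facetNumbers [Fintype V] (hconn : G.Connected) (hG : tightKer G 0 = ⊥)
    {d : ℕ} (hd : 0 < d) (hV : Fintype.card V = d + 1) :
    ∃ m ∈ facetNumbers d, (facetVectors G).encard ≤ m := by
  have φ := G.overFinIso hV
  have hH := tightKer_zero_eq_bot_of_iso φ.symm hG
  refine ⟨_, ⟨d + 1, G.overFin hV, φ.connected_iff.1 hconn, ?_, rfl⟩, ?_⟩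
  · rw [convexDim_edgePolytope, hH, finrank_bot, Fintype.card_fin]
    push_cast
    ring
  · rw [numFacets_eq_encard_facetVectors hH (by simp; omega)]
    have hinj : Function.Injective fun a : V → ℝ => a ∘ φ.symm :=
      φ.symm.surjective.injective_comp_right
    rw [← hinj.encard_image]
    refine encard_le_encard ?_
    rintro _ ⟨a, ha, rfl⟩
    exact comp_mem_facetVectors φ.symm ha

end FacetVectors

/-! ### Pendant vertices -/

section Pendant

variable {V : Type*} {G : SimpleGraph V}

/-- The graph `G` with one new vertex `none`, adjacent only to the old vertex `u`. -/
def pendant (G : SimpleGraph V) (u : V) : SimpleGraph (Option V) where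
  Adj x y := (∃ v w, x = some v ∧ y = some w ∧ G.Adj v w) ∨ (x = none ∧ y = some u) ∨
    (x = some u ∧ y = none)
  symm := ⟨by
    rintro x y (⟨v, w, rfl, rfl, h⟩ | ⟨rfl, rfl⟩ | ⟨rfl, rfl⟩)
    · exact Or.inl ⟨w, v, rfl, rfl, h.symm⟩
    · exact Or.inr (Or.inr ⟨rfl, rfl⟩)
    · exact Or.inr (Or.inl ⟨rfl, rfl⟩)⟩
  loopless := ⟨by
    rintro x (⟨v, w, rfl, h, h'⟩ | ⟨rfl, h⟩ | ⟨rfl, h⟩)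
    · cases h
      exact h'.ne rfl
    · cases h
    · cases h⟩

theorem pendant_adj_some {u v w : V} (h : G.Adj v w) : (pendant G u).Adj (some v) (some w) :=
  Or.inl ⟨v, w, rfl, rfl, h⟩

theorem pendant_adj_none (u : V) : (pendant G u).Adj none (some u) :=
  Or.inr (Or.inl ⟨rfl, rfl⟩)

theorem pendant_connected (hG : G.Connected) (u : V) : (pendant G u).Connected := by
  have hreach : ∀ v, (pendant G u).Reachable (some v) (some u) := by
    intro v
    let ι : G →g pendant G u := ⟨some, fun h => pendant_adj_some h⟩
    exact (hG.preconnected v u).map ι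
  rw [SimpleGraph.connected_iff_exists_forall_reachable]
  refine ⟨some u, fun x => ?_⟩
  cases x with
  | none => exact (pendant_adj_none u).reachable.symm
  | some v => exact (hreach v).symm

theorem tightKer_pendant_eq_bot (hG : tightKer G 0 = ⊥) (u : V) :
    tightKer (pendant G u) 0 = ⊥ := by
  rw [eq_bot_iff]
  intro b hb
  have hb' := mem_tightKer_zero.1 hb
  have : b ∘ some ∈ tightKer G 0 := mem_tightKer_zero.2 fun i j hij =>
    hb' _ _ (pendant_adj_some hij)
  rw [hG, Submodule.mem_bot] at this
  have hsome : ∀ v, b (some v) = 0 := fun v => congrFun this v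
  rw [Submodule.mem_bot]
  ext x
  cases x with
  | none => simpa [hsome u] using hb' _ _ (pendant_adj_none u)
  | some v => exact hsome v

/-- Facet vectors extend to a pendant vertex, with the value that makes the new edge tight. -/
theorem extend_mem_facetVectors_pendant (u : V) {a : V → ℝ} (ha : a ∈ facetVectors G) :
    (fun x => Option.elim x (-a u) a : Option V → ℝ) ∈ facetVectors (pendant G u) := by
  obtain ⟨h1, h2, h3, h4⟩ := ha
  refine ⟨?_, fun h => h2 ?_, ?_, ?_⟩
  · rintro (_ | v)
    · rcases h1 u with h | h | h <;> simp [h]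
    · exact h1 v
  · ext v
    exact congrFun h (some v)
  · rintro x y (⟨v, w, rfl, rfl, h⟩ | ⟨rfl, rfl⟩ | ⟨rfl, rfl⟩)
    · exact h3 v w h
    · simp
    · simp
  · intro b hb
    obtain ⟨t, ht⟩ := h4 (b ∘ some) fun i j hij h0 => hb _ _ (pendant_adj_some hij) h0
    have hsome : ∀ v, b (some v) = t * a v := fun v => congrFun ht v
    refine ⟨t, ?_⟩
    ext x
    cases x with
    | none =>
      have := hb _ _ (pendant_adj_none u) (by simp)
      rw [hsome] at this
      simp only [Pi.smul_apply, smul_eq_mul, Option.elim_none]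
      linarith
    | some v => exact hsome v

theorem encard_facetVectors_le_pendant (G : SimpleGraph V) (u : V) :
    (facetVectors G).encard ≤ (facetVectors (pendant G u)).encard := by
  have hinj : Function.Injective
      fun (a : V → ℝ) => (fun x => Option.elim x (-a u) a : Option V → ℝ) := by
    intro a b h
    ext v
    exact congrFun h (some v)
  rw [← hinj.encard_image]
  refine encard_le_encard ?_
  rintro _ ⟨a, ha, rfl⟩
  exact extend_mem_facetVectors_pendant u ha

end Pendant

/-! ### Windmill graphs -/

section Windmill

variable {k : ℕ}

theorem windmill_adj_none (p : Fin k × Fin 3) : (windmill k).Adj none (some p) :=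
  ⟨by simp, by simp⟩

theorem windmill_adj_some (i : Fin k) {x y : Fin 3} (h : x ≠ y) :
    (windmill k).Adj (some (i, x)) (some (i, y)) :=
  ⟨by simpa using h, by rintro p q ⟨⟩ ⟨⟩; rfl⟩

/-- A property of the ordered edges of a windmill graph can be checked on the three kinds of
edges: out of the centre, into the centre, and within one copy. -/
theorem windmill_adj_cases {P : Option (Fin k × Fin 3) → Option (Fin k × Fin 3) → Prop}
    (h1 : ∀ p, P none (some p)) (h2 : ∀ p, P (some p) none)
    (h3 : ∀ i x y, x ≠ y → P (some (i, x)) (some (i, y))) :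
    ∀ u v, (windmill k).Adj u v → P u v := by
  rintro (_ | ⟨i, x⟩) (_ | ⟨j, y⟩) ⟨hne, hsame⟩
  · exact absurd rfl hne
  · exact h1 _
  · exact h2 _
  · obtain rfl : i = j := hsame (i, x) (j, y) rfl rfl
    exact h3 i x y (by simpa using hne)

theorem windmill_connected (k : ℕ) : (windmill k).Connected := by
  rw [SimpleGraph.connected_iff_exists_forall_reachable]
  refine ⟨none, fun x => ?_⟩
  cases x with
  | none => exact SimpleGraph.Reachable.refl _
  | some p => exact (windmill_adj_none p).reachable

theorem tightKer_windmill_eq_bot (hk : 1 ≤ k) : tightKer (windmill k) 0 = ⊥ := by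
  rw [eq_bot_iff]
  intro b hb
  have hb' := mem_tightKer_zero.1 hb
  have h0 : b none = 0 := by
    have h1 := hb' _ _ (windmill_adj_none (⟨0, hk⟩, 0))
    have h2 := hb' _ _ (windmill_adj_none (⟨0, hk⟩, 1))
    have h3 := hb' _ _ (windmill_adj_some (⟨0, hk⟩ : Fin k) (x := 0) (y := 1) (by decide))
    linarith
  rw [Submodule.mem_bot]
  ext x
  cases x with
  | none => exact h0
  | some p => simpa [h0] using hb' _ _ (windmill_adj_none p)

/-- At a vertex with value `1` and no neighbour of value `-1`, a facet vector is a unit vector. -/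
theorem eq_single_of_mem_facetVectors {V : Type*} [DecidableEq V] {G : SimpleGraph V} {a : V → ℝ}
    (ha : a ∈ facetVectors G) {v : V} (hv : a v = 1) (h : ∀ w, G.Adj v w → a w ≠ -1) :
    a = Pi.single v 1 := by
  have hmem : (Pi.single v 1 : V → ℝ) ∈ tightKer G a := by
    intro i j hij h0
    have hi : i ≠ v := by
      rintro rfl
      exact h j hij (by linarith)
    have hj : j ≠ v := by
      rintro rfl
      exact h i hij.symm (by linarith)
    simp [hi, hj]
  obtain ⟨t, ht⟩ := ha.2.2.2 _ hmem
  have htv := congrFun ht v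
  simp only [Pi.single_eq_same, Pi.smul_apply, hv, smul_eq_mul, mul_one] at htv
  rw [ht, ← htv, one_smul]

/-- The normal with value `1` at the centre: each copy of the triangle carries either zeros only, or
`-1` at the vertex chosen by `f` and `1` at the other two. -/
def bladeNormal (f : Fin k → Option (Fin 3)) (v : Option (Fin k × Fin 3)) : ℝ :=
  v.elim 1 fun p => (f p.1).elim 0 fun m => if p.2 = m then -1 else 1

/-- The normal with value `-1` at the centre and `1` elsewhere. -/
def centerNormal (k : ℕ) (v : Option (Fin k × Fin 3)) : ℝ :=
  v.elim (-1) fun _ => 1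

theorem bladeNormal_mem_facetVectors (f : Fin k → Option (Fin 3)) :
    bladeNormal f ∈ facetVectors (windmill k) := by
  refine ⟨?_, ?_, ?_, ?_⟩
  · rintro (_ | ⟨i, x⟩)
    · simp [bladeNormal]
    · cases hf : f i
      · simp [bladeNormal, hf]
      · simp only [bladeNormal, hf, Option.elim_some]
        split_ifs <;> simp
  · intro h
    simpa [bladeNormal] using congrFun h none
  · refine windmill_adj_cases ?_ ?_ ?_
    · rintro ⟨i, x⟩
      cases hf : f i
      · simp [bladeNormal, hf]
      · simp only [bladeNormal, hf, Option.elim_some, Option.elim_none]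
        split_ifs <;> norm_num
    · rintro ⟨i, x⟩
      cases hf : f i
      · simp [bladeNormal, hf]
      · simp only [bladeNormal, hf, Option.elim_some, Option.elim_none]
        split_ifs <;> norm_num
    · intro i x y hxy
      cases hf : f i
      · simp [bladeNormal, hf]
      · simp only [bladeNormal, hf, Option.elim_some]
        split_ifs with h1 h2
        · exact absurd (h1.trans h2.symm) hxy
        all_goals norm_num
  · intro b hb
    refine ⟨b none, ?_⟩
    ext v
    rcases v with _ | ⟨i, x⟩
    · simp [bladeNormal]
    cases hf : f i with
    | none =>
      -- The whole triangle is tight, so `b` vanishes on it.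
      have h01 := hb _ _ (windmill_adj_some i (x := 0) (y := 1) (by decide))
        (by simp [bladeNormal, hf])
      have h02 := hb _ _ (windmill_adj_some i (x := 0) (y := 2) (by decide))
        (by simp [bladeNormal, hf])
      have h12 := hb _ _ (windmill_adj_some i (x := 1) (y := 2) (by decide))
        (by simp [bladeNormal, hf])
      have : b (some (i, x)) = 0 := by
        match x with
        | 0 => linarith
        | 1 => linarith
        | 2 => linarith
      simp [bladeNormal, hf, this]
    | some m =>
      have hm := hb _ _ (windmill_adj_none (i, m)) (by simp [bladeNormal, hf])
      by_cases hx : x = m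
      · subst hx
        simp only [bladeNormal, hf, Option.elim_some, Pi.smul_apply, smul_eq_mul, if_true]
        linarith
      · have hxm := hb _ _ (windmill_adj_some i hx) (by simp [bladeNormal, hf, hx])
        simp only [bladeNormal, hf, Option.elim_some, Pi.smul_apply, smul_eq_mul, if_neg hx]
        linarith

theorem single_mem_facetVectors_windmill (p : Fin k × Fin 3) :
    (Pi.single (some p) 1 : Option (Fin k × Fin 3) → ℝ) ∈ facetVectors (windmill k) := by
  have hnn : ∀ v, 0 ≤ (Pi.single (some p) 1 : Option (Fin k × Fin 3) → ℝ) v := by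
    intro v
    rw [Pi.single_apply]
    split_ifs <;> norm_num
  refine ⟨?_, ?_, fun i j _ => add_nonneg (hnn i) (hnn j), ?_⟩
  · intro v
    rw [Pi.single_apply]
    split_ifs <;> simp
  · simp
  · intro b hb
    have hcenter : ∀ q, q ≠ p → b none + b (some q) = 0 := fun q hq =>
      hb _ _ (windmill_adj_none q) (by simp [hq])
    obtain ⟨i, x⟩ := p
    -- The centre and the other two vertices of the same copy form a tight triangle.
    obtain ⟨y, z, hy, hz, hyz⟩ : ∃ y z : Fin 3, y ≠ x ∧ z ≠ x ∧ y ≠ z :=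
      (by decide : ∀ x : Fin 3, ∃ y z : Fin 3, y ≠ x ∧ z ≠ x ∧ y ≠ z) x
    have hyz' := hb _ _ (windmill_adj_some i hyz) (by simp [hy, hz])
    have h0 : b none = 0 := by
      have h1 := hcenter (i, y) (by simp [hy])
      have h2 := hcenter (i, z) (by simp [hz])
      linarith
    refine ⟨b (some (i, x)), ?_⟩
    ext v
    rcases v with _ | q
    · simp [h0]
    · by_cases hq : q = (i, x)
      · simp [hq]
      · simpa [hq, h0] using hcenter q hq

theorem centerNormal_mem_facetVectors (k : ℕ) :
    centerNormal k ∈ facetVectors (windmill k) := by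
  refine ⟨?_, ?_, ?_, ?_⟩
  · rintro (_ | p) <;> simp [centerNormal]
  · intro h
    simpa [centerNormal] using congrFun h none
  · refine windmill_adj_cases ?_ ?_ ?_ <;> intros <;> norm_num [centerNormal]
  · intro b hb
    refine ⟨-b none, ?_⟩
    ext v
    rcases v with _ | p
    · simp [centerNormal]
    · have := hb _ _ (windmill_adj_none p) (by simp [centerNormal])
      simp only [centerNormal, Option.elim_some, Pi.smul_apply, smul_eq_mul]
      linarith

/-- All facet normals of a windmill graph: those with value `1`, `0`, `-1` at the centre. -/
def windmillNormal (k : ℕ) :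
    (Fin k → Option (Fin 3)) ⊕ Option (Fin k × Fin 3) → Option (Fin k × Fin 3) → ℝ
  | .inl f => bladeNormal f
  | .inr (some p) => Pi.single (some p) 1
  | .inr none => centerNormal k

theorem windmillNormal_injective (k : ℕ) : Function.Injective (windmillNormal k) := by
  rintro (f | _ | p) (g | _ | q) h
  · congr 1
    ext1 i
    have hi : ∀ x, bladeNormal f (some (i, x)) = bladeNormal g (some (i, x)) := fun x =>
      congrFun h _
    simp only [bladeNormal, Option.elim_some] at hi
    cases hf : f i with
    | none =>
      cases hg : g i with
      | none => rfl
      | some n => simpa [hf, hg] using hi n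
    | some m =>
      have hm := hi m
      cases hg : g i with
      | none => simp [hf, hg] at hm
      | some n =>
        simp only [hf, hg, Option.elim_some, if_true] at hm
        split_ifs at hm with hmn
        · rw [hmn]
        · norm_num at hm
  · have := congrFun h none
    norm_num [windmillNormal, bladeNormal, centerNormal] at this
  · have := congrFun h none
    simp [windmillNormal, bladeNormal] at this
  · have := congrFun h none
    norm_num [windmillNormal, bladeNormal, centerNormal] at this
  · rfl
  · have := congrFun h none
    simp [windmillNormal, centerNormal] at this
  · have := congrFun h none
    simp [windmillNormal, bladeNormal] at this
  · have := congrFun h none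
    simp [windmillNormal, centerNormal] at this
  · have := congrFun h (some p)
    by_contra hne
    have hpq : p ≠ q := by
      rintro rfl
      exact hne rfl
    simp [windmillNormal, hpq] at this

/-- A facet vector takes the value `1`, `0` or `-1` at the centre. For `-1` all other values are
forced. For `0` there is no negative value, so it is a unit vector. For `1`, a copy without
negative value carries only zeros, as otherwise the vector would be a unit vector away from the
centre. -/
theorem facetVectors_windmill (k : ℕ) : facetVectors (windmill k) = range (windmillNormal k) := by
  refine Subset.antisymm ?_ ?_
  · intro a ha
    obtain ⟨hs, hne, hsupp, -⟩ := id ha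
    have hcen : ∀ p, 0 ≤ a none + a (some p) := fun p => hsupp _ _ (windmill_adj_none p)
    rcases hs none with hz | hz | hz
    · refine ⟨.inr none, ?_⟩
      ext v
      rcases v with _ | p
      · exact hz.symm
      · have := hcen p
        change (1 : ℝ) = a (some p)
        rcases hs (some p) with h | h | h <;> linarith
    · obtain ⟨v, hv⟩ := Function.ne_iff.1 hne
      have hneg : ∀ w, a w ≠ -1 := by
        rintro (_ | p) h
        · linarith
        · linarith [hcen p]
      have hv1 : a v = 1 := by
        rcases hs v with h | h | h
        · exact absurd h (hneg v)
        · exact absurd h hv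
        · exact h
      rcases v with _ | p
      · linarith
      · exact ⟨.inr (some p), (eq_single_of_mem_facetVectors ha hv1 fun w _ => hneg w).symm⟩
    · have hex : ∀ i, ∃ o : Option (Fin 3), ∀ x,
          a (some (i, x)) = o.elim 0 fun m => if x = m then -1 else 1 := by
        intro i
        by_cases hm : ∃ m, a (some (i, m)) = -1
        · obtain ⟨m, hm⟩ := hm
          refine ⟨some m, fun x => ?_⟩
          simp only [Option.elim_some]
          split_ifs with hx
          · rw [hx, hm]
          · have := hsupp _ _ (windmill_adj_some i hx)
            rcases hs (some (i, x)) with h | h | h <;> linarith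
        · push Not at hm
          refine ⟨none, fun x => ?_⟩
          rcases hs (some (i, x)) with h | h | h
          · exact absurd h (hm x)
          · exact h
          · have hsingle := eq_single_of_mem_facetVectors ha h (by
              rintro (_ | ⟨j, y⟩) hadj
              · rw [hz]
                norm_num
              · obtain rfl : i = j := hadj.2 _ _ rfl rfl
                exact hm y)
            rw [hsingle] at hz
            simp at hz
      choose f hf using hex
      refine ⟨.inl f, ?_⟩
      ext v
      rcases v with _ | ⟨i, x⟩
      · exact hz.symm
      · exact (hf i x).symm
  · rintro _ ⟨f | _ | p, rfl⟩
    · exact bladeNormal_mem_facetVectors f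
    · exact centerNormal_mem_facetVectors k
    · exact single_mem_facetVectors_windmill p

theorem encard_facetVectors_windmill (k : ℕ) :
    (facetVectors (windmill k)).encard = ((4 ^ k + 3 * k + 1 : ℕ) : ℕ∞) := by
  rw [facetVectors_windmill, ← image_univ, (windmillNormal_injective k).encard_image, encard_univ,
    ENat.card_eq_coe_fintype_card]
  congr 1
  simp
  ring

theorem card_windmill_vertices (k : ℕ) : Fintype.card (Option (Fin k × Fin 3)) = 3 * k + 1 := by
  simp
  ring

end Windmill

/-! ### The extremal function -/

/-- Pendant vertices raise the dimension of a windmill polytope without losing facets. -/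
theorem exists_graph_with_many_facetVectors {k : ℕ} (hk : 1 ≤ k) (r : ℕ) :
    ∃ (V : Type) (_ : Fintype V) (G : SimpleGraph V), G.Connected ∧ tightKer G 0 = ⊥ ∧
      Fintype.card V = 3 * k + r + 1 ∧ ((4 ^ k + 1 : ℕ) : ℕ∞) ≤ (facetVectors G).encard := by
  induction r with
  | zero =>
    refine ⟨_, inferInstance, windmill k, windmill_connected k, tightKer_windmill_eq_bot hk,
      card_windmill_vertices k, ?_⟩
    rw [encard_facetVectors_windmill]
    exact Nat.cast_le.2 (by omega)
  | succ r ih =>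
    obtain ⟨V, _, G, hconn, hG, hV, hcard⟩ := ih
    have hne : Nonempty V := hconn.nonempty
    refine ⟨Option V, inferInstance, pendant G (Classical.arbitrary V), pendant_connected hconn _,
      tightKer_pendant_eq_bot hG _, ?_, hcard.trans (encard_facetVectors_le_pendant _ _)⟩
    rw [Fintype.card_option, hV]
    ring

theorem exists_mem_facetNumbers_gt {d : ℕ} (hd : 3 ≤ d) :
    ∃ m ∈ facetNumbers d, (4 : ℕ∞) ^ (d / 3) < m := by
  obtain ⟨V, _, G, hconn, hG, hV, hcard⟩ :=
    exists_graph_with_many_facetVectors (k := d / 3) (by omega) (d % 3)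
  obtain ⟨m, hm, hle⟩ := exists_mem_facetNumbers (d := d) hconn hG (by omega) (by omega)
  refine ⟨m, hm, lt_of_lt_of_le ?_ (hcard.trans hle)⟩
  exact_mod_cast Nat.lt_succ_self (4 ^ (d / 3))

theorem le_of_mem_facetNumbers {d : ℕ} (hd : 3 ≤ d) {m : ℕ∞} (hm : m ∈ facetNumbers d) :
    m ≤ ((2 ^ d + d : ℕ) : ℕ∞) := by
  obtain ⟨n, G, hconn, hdim, rfl⟩ := hm
  exact numFacets_edgePolytope_le hconn hd hdim

/-- A nonempty set of extended natural numbers with a finite bound attains its supremum. -/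
theorem isGreatest_maxFacets {d : ℕ} (hd : 3 ≤ d) :
    IsGreatest (facetNumbers d) (maxFacets d) := by
  obtain ⟨m, hm, -⟩ := exists_mem_facetNumbers_gt hd
  have : Nonempty (facetNumbers d) := ⟨m, hm⟩
  refine ⟨ENat.sSup_mem_of_nonempty_of_lt_top ?_, fun x hx => le_sSup hx⟩
  exact (sSup_le fun x hx => le_of_mem_facetNumbers hd hx).trans_lt (ENat.natCast_lt_top _)

end EdgePolytope

theorem mainTheorem1 :
    (∀ d : ℕ, 3 ≤ d →
      IsGreatest (EdgePolytope.facetNumbers d) (EdgePolytope.maxFacets d) ∧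
      (4 : ℕ∞) ^ (d / 3) < EdgePolytope.maxFacets d ∧
      EdgePolytope.maxFacets d ≤ (2 : ℕ∞) ^ d + (d : ℕ∞)) ∧
    (∀ k : ℕ, 1 ≤ k →
      (EdgePolytope.windmill k).Connected ∧
      EdgePolytope.convexDim (EdgePolytope.edgePolytope (EdgePolytope.windmill k)) =
        3 * (k : ℤ) ∧
      EdgePolytope.numFacets (EdgePolytope.edgePolytope (EdgePolytope.windmill k)) =
        (4 : ℕ∞) ^ k + 3 * (k : ℕ∞) + 1) := by
  refine ⟨fun d hd => ⟨EdgePolytope.isGreatest_maxFacets hd, ?_, ?_⟩, fun k hk =>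
    ⟨EdgePolytope.windmill_connected k, ?_, ?_⟩⟩
  · obtain ⟨m, hm, hlt⟩ := EdgePolytope.exists_mem_facetNumbers_gt hd
    exact hlt.trans_le (le_sSup hm)
  · refine sSup_le fun m hm => ?_
    exact_mod_cast EdgePolytope.le_of_mem_facetNumbers hd hm
  · rw [EdgePolytope.convexDim_edgePolytope, EdgePolytope.tightKer_windmill_eq_bot hk,
      finrank_bot, EdgePolytope.card_windmill_vertices]
    push_cast
    ring
  · rw [EdgePolytope.numFacets_eq_encard_facetVectors (EdgePolytope.tightKer_windmill_eq_bot hk)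
      (by rw [EdgePolytope.card_windmill_vertices]; omega),
      EdgePolytope.encard_facetVectors_windmill]
    push_cast
    ring
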